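/- For integers $k,m\ge 1$ let $x\in\mathbb{R}^k$ and $y\in\mathbb{R}^m$ be independent standard Gaussian vectors, and equip $\mathbb{R}^{k\times m}$ with the Frobenius inner product. The Segre zonoid $C(k,m)\subseteq\mathbb{R}^{k\times m}$ is the zonoid $\mathbb{E}\,[0,xy^T]$ associated with the random matrix $xy^T$, i.e., the convex body whose support function is $u\mapsto \mathbb{E}\,\max\{0,\langle u,xy^T\rangle\}=\frac12\,\mathbb{E}\,|\langle u,xy^T\rangle|$. Let $\rho_k:=\mathbb{E}\,\|x\|$, and let $B(k,m):=\{X\in\mathbb{R}^{k\times m} : \|X\|_F\le \rho_k/\sqrt{2\pi k}\}$. Write $|\cdot|$ for Lebesgue measure on $\mathbb{R}^{k\times m}$. Theorem. Let $k\ge 1$ be fixed. (a) For every $m\ge k$ the ball $B(k,m)$ is a ball of smallest radius containing $C(k,m)$: we have $C(k,m)\subseteq B(k,m)$, and every closed ball (with any center) that contains $C(k,m)$ has radius at least $\rho_k/\sqrt{2\pi k}$. Moreover $|C(k,m)|>0$. (b) As $m\to\infty$, $$\log|C(k,m)|=\log|B(k,m)|-\mathcal{O}(\log m),$$ where the implied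 constant may depend on $k$. (By (a), $|C(k,m)|\le|B(k,m)|$ for $m\ge k$, so the difference is nonnegative there.) -/

import Mathlib

open MeasureTheory ProbabilityTheory Filter Asymptotics
open scoped RealInnerProductSpace

/-- The support function `h_K(u) = sup {⟪x, u⟫ | x ∈ K}` of a subset `K` of a Euclidean space. -/
noncomputable def supportFn {E : Type*} [NormedAddCommGroup E] [InnerProductSpace ℝ E]
    (K : Set E) (u : E) : ℝ :=
  sSup ((fun x : E => ⟪x, u⟫) '' K)

/-- The expectation `𝔼 X` of a random convex body `X`: the convex body whose support function is
`u ↦ 𝔼 h_X(u)`. A convex body with support function `h` is the set of all `x` with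
`⟪x, u⟫ ≤ h(u)` for every `u`. -/
noncomputable def bodyExpectation {Ω E : Type*} [MeasurableSpace Ω] [NormedAddCommGroup E]
    [InnerProductSpace ℝ E] (P : Measure Ω) (X : Ω → Set E) : Set E :=
  {x | ∀ u : E, ⟪x, u⟫ ≤ ∫ ω, supportFn (X ω) u ∂P}

/-- The zonoid `C_Y = 𝔼 [0, Y]` associated with a random vector `Y`. -/
noncomputable def zonoidOf {Ω E : Type*} [MeasurableSpace Ω] [NormedAddCommGroup E]
    [InnerProductSpace ℝ E] (P : Measure Ω) (Y : Ω → E) : Set E :=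
  bodyExpectation P (fun ω => segment ℝ 0 (Y ω))

/-- The space of real `k × m` matrices with the Frobenius inner product. -/
abbrev MatSpace (k m : ℕ) : Type := EuclideanSpace ℝ (Fin k × Fin m)

/-- The rank-one matrix `x yᵀ`. -/
noncomputable def outerProd {k m : ℕ} (x : EuclideanSpace ℝ (Fin k))
    (y : EuclideanSpace ℝ (Fin m)) : MatSpace k m :=
  WithLp.toLp 2 (fun p : Fin k × Fin m => x p.1 * y p.2)

/-- The Segre zonoid `C(k,m)`: the zonoid of `x yᵀ` for independent standard Gaussian vectors
`x ∈ ℝ^k` and `y ∈ ℝ^m`. -/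
noncomputable def segreZonoid (k m : ℕ) : Set (MatSpace k m) :=
  zonoidOf ((stdGaussian (EuclideanSpace ℝ (Fin k))).prod (stdGaussian (EuclideanSpace ℝ (Fin m))))
    (fun p => outerProd p.1 p.2)

/-- `ρ_k = 𝔼 ‖x‖` for a standard Gaussian vector `x ∈ ℝ^k`. -/
noncomputable def gaussRho (k : ℕ) : ℝ :=
  ∫ x, ‖x‖ ∂(stdGaussian (EuclideanSpace ℝ (Fin k)))

/-- The radius `R_k = ρ_k / √(2πk)`. -/
noncomputable def segreRadius (k : ℕ) : ℝ :=
  gaussRho k / Real.sqrt (2 * Real.pi * k)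

/-- The ball `B(k,m)` of radius `R_k` about the origin, in the Frobenius norm. -/
noncomputable def segreBall (k m : ℕ) : Set (MatSpace k m) :=
  Metric.closedBall 0 (segreRadius k)

theorem supportFn_segment {E : Type*} [NormedAddCommGroup E] [InnerProductSpace ℝ E] (y u : E) :
    supportFn (segment ℝ 0 y) u = max 0 ⟪y, u⟫ := by
  have hl : IsGreatest ((fun x : E => ⟪x, u⟫) '' segment ℝ 0 y) (max 0 ⟪y, u⟫) := by
    constructor
    · rcases le_total 0 ⟪y, u⟫ with h | h
      · rw [max_eq_right h]
        exact ⟨y, right_mem_segment ℝ 0 y, rfl⟩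
      · rw [max_eq_left h]
        exact ⟨0, left_mem_segment ℝ 0 y, inner_zero_left u⟩
    · rintro _ ⟨x, ⟨a, b, ha, hb, hab, rfl⟩, rfl⟩
      simp only [smul_zero, zero_add, real_inner_smul_left]
      calc b * ⟪y, u⟫ ≤ b * max 0 ⟪y, u⟫ := mul_le_mul_of_nonneg_left (le_max_right _ _) hb
        _ ≤ 1 * max 0 ⟪y, u⟫ := mul_le_mul_of_nonneg_right (by linarith) (le_max_left _ _)
        _ = _ := one_mul _
  exact hl.csSup_eq

/-- `zonoidOf P Y` is a convex body and its support function is the expected support function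
of the random segment `[0, Y]`. -/
theorem zonoidOf_spec {Ω E : Type*} [MeasurableSpace Ω] [NormedAddCommGroup E]
    [InnerProductSpace ℝ E] [FiniteDimensional ℝ E] (P : Measure Ω) (Y : Ω → E)
    (hY : Integrable Y P) :
    Convex ℝ (zonoidOf P Y) ∧ IsCompact (zonoidOf P Y) ∧ (zonoidOf P Y).Nonempty ∧
      ∀ u : E, supportFn (zonoidOf P Y) u = ∫ ω, supportFn (segment ℝ 0 (Y ω)) u ∂P := by
  set h : E → ℝ := fun u => ∫ ω, supportFn (segment ℝ 0 (Y ω)) u ∂P with hh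
  have hmem : ∀ x, x ∈ zonoidOf P Y ↔ ∀ u, ⟪x, u⟫ ≤ h u := fun x => Iff.rfl
  have hmax : ∀ u, h u = ∫ ω, max 0 ⟪Y ω, u⟫ ∂P := fun u => by
    simp only [hh, supportFn_segment]
  have hint : ∀ u, Integrable (fun ω => max 0 ⟪Y ω, u⟫) P := fun u =>
    (integrable_zero _ _ _).sup (hY.inner_const u)
  have h0 : h 0 = 0 := by simp [hmax]
  have hnn : ∀ u, 0 ≤ h u := fun u => by
    rw [hmax]; exact integral_nonneg fun ω => le_max_left _ _
  have hadd : ∀ u v, h (u + v) ≤ h u + h v := fun u v => by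
    rw [hmax, hmax, hmax, ← integral_add (hint u) (hint v)]
    refine integral_mono (hint _) ((hint u).add (hint v)) fun ω => ?_
    simp only [inner_add_right]
    exact max_le (add_nonneg (le_max_left _ _) (le_max_left _ _))
      (add_le_add (le_max_right _ _) (le_max_right _ _))
  have hsmul : ∀ c : ℝ, 0 < c → ∀ u, h (c • u) = c * h u := fun c hc u => by
    rw [hmax, hmax, ← integral_const_mul]
    congr 1; ext ω
    rw [real_inner_smul_right, mul_max_of_nonneg _ _ hc.le, mul_zero]
  have hbd : ∀ u, h u ≤ (∫ ω, ‖Y ω‖ ∂P) * ‖u‖ := fun u => by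
    rw [hmax, ← integral_mul_const]
    refine integral_mono (hint u) (hY.norm.mul_const _) fun ω => ?_
    exact max_le (by positivity) (real_inner_le_norm _ _)
  have hz : (0 : E) ∈ zonoidOf P Y := (hmem 0).2 fun u => by simpa using hnn u
  refine ⟨?_, ?_, ⟨0, hz⟩, ?_⟩
  · intro x hx y hy a b ha hb hab u
    have h1 := mul_le_mul_of_nonneg_left ((hmem x).1 hx u) ha
    have h2 := mul_le_mul_of_nonneg_left ((hmem y).1 hy u) hb
    have h3 : a * h u + b * h u = h u := by rw [← add_mul, hab, one_mul]
    rw [inner_add_left, real_inner_smul_left, real_inner_smul_left]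
    change _ ≤ h u
    linarith
  · have hcl : IsClosed (zonoidOf P Y) := by
      have : zonoidOf P Y = ⋂ u, {x : E | ⟪x, u⟫ ≤ h u} := by
        ext x; simp [hmem]
      rw [this]
      exact isClosed_iInter fun u => isClosed_le (by fun_prop) continuous_const
    refine Metric.isCompact_of_isClosed_isBounded hcl ?_
    refine (Metric.isBounded_closedBall (x := (0 : E)) (r := ∫ ω, ‖Y ω‖ ∂P)).subset ?_
    intro x hx
    rw [mem_closedBall_zero_iff]
    have h1 := ((hmem x).1 hx x).trans (hbd x)
    rw [real_inner_self_eq_norm_mul_norm] at h1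
    rcases (norm_nonneg x).eq_or_lt with h2 | h2
    · rw [← h2]; exact integral_nonneg fun ω => norm_nonneg _
    · exact le_of_mul_le_mul_right h1 h2
  · intro u
    refine IsGreatest.csSup_eq ⟨?_, ?_⟩
    · change h u ∈ _
      rcases eq_or_ne u 0 with rfl | hu
      · exact ⟨0, hz, by simp [h0]⟩
      obtain ⟨g, hg1, hg2⟩ := exists_extension_of_le_sublinear
        (LinearPMap.mkSpanSingleton u (h u) hu) h hsmul hadd (by
          rintro ⟨x, hx⟩
          obtain ⟨c, rfl⟩ := Submodule.mem_span_singleton.1 hx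
          rw [LinearPMap.mkSpanSingleton'_apply, smul_eq_mul, RingHom.id_apply]
          rcases lt_trichotomy c 0 with hc | rfl | hc
          · have h1 := hsmul (-c) (by linarith) u
            have h2 := hadd (c • u) ((-c) • u)
            rw [← add_smul, add_neg_cancel, zero_smul, h0, h1] at h2
            change c * h u ≤ h (c • u)
            linarith
          · simp [h0]
          · exact (hsmul c hc u).ge)
      have hin : ∀ v, ⟪(InnerProductSpace.toDual ℝ E).symm (LinearMap.toContinuousLinearMap g), v⟫
          = g v := fun v => by
        rw [InnerProductSpace.toDual_symm_apply]; rfl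
      refine ⟨(InnerProductSpace.toDual ℝ E).symm (LinearMap.toContinuousLinearMap g),
        (hmem _).2 fun v => by rw [hin]; exact hg2 v, ?_⟩
      change ⟪_, u⟫ = _
      rw [hin]
      have h1 := hg1 ⟨u, Submodule.mem_span_singleton_self u⟩
      have h2 := LinearPMap.mkSpanSingleton_apply (σ := RingHom.id ℝ) ℝ ℝ hu (h u)
      exact h1.trans h2
    · rintro _ ⟨x, hx, rfl⟩
      exact (hmem x).1 hx u

theorem norm_outerProd {k m : ℕ} (x : EuclideanSpace ℝ (Fin k)) (y : EuclideanSpace ℝ (Fin m)) :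
    ‖outerProd x y‖ = ‖x‖ * ‖y‖ := by
  rw [EuclideanSpace.norm_eq, EuclideanSpace.norm_eq, EuclideanSpace.norm_eq,
    ← Real.sqrt_mul (Finset.sum_nonneg fun i _ => sq_nonneg _), Finset.sum_mul_sum,
    Fintype.sum_prod_type]
  simp [outerProd, mul_pow]

/-- The random matrix `x yᵀ` is integrable, so its zonoid is a convex body. -/
theorem integrable_outerProd (k m : ℕ) :
    Integrable (fun p : EuclideanSpace ℝ (Fin k) × EuclideanSpace ℝ (Fin m) => outerProd p.1 p.2)
      ((stdGaussian (EuclideanSpace ℝ (Fin k))).prod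
        (stdGaussian (EuclideanSpace ℝ (Fin m)))) := by
  have h1 : Integrable (fun x => ‖x‖) (stdGaussian (EuclideanSpace ℝ (Fin k))) :=
    (IsGaussian.integrable_id (μ := stdGaussian (EuclideanSpace ℝ (Fin k)))).norm
  have h2 : Integrable (fun x => ‖x‖) (stdGaussian (EuclideanSpace ℝ (Fin m))) :=
    (IsGaussian.integrable_id (μ := stdGaussian (EuclideanSpace ℝ (Fin m)))).norm
  refine (h1.mul_prod h2).mono' ?_ (Eventually.of_forall fun p => (norm_outerProd _ _).le)
  refine Continuous.aestronglyMeasurable ?_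
  unfold outerProd
  fun_prop

/-- `C(k,m)` is a convex body with support function `u ↦ 𝔼 h_{[0, x yᵀ]}(u)`. -/
theorem segreZonoid_spec (k m : ℕ) :
    Convex ℝ (segreZonoid k m) ∧ IsCompact (segreZonoid k m) ∧ (segreZonoid k m).Nonempty ∧
      ∀ u : MatSpace k m, supportFn (segreZonoid k m) u =
        ∫ p, supportFn (segment ℝ 0 (outerProd p.1 p.2)) u
          ∂((stdGaussian (EuclideanSpace ℝ (Fin k))).prod
            (stdGaussian (EuclideanSpace ℝ (Fin m)))) :=
  zonoidOf_spec _ _ (integrable_outerProd k m)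

/-! Conditioning on `x`, the support function of C(k,m) at `U` is E‖Uᵀx‖/√(2π). Everything rests on
one isotropy identity, `integral_inner_transposeMulVec_div_norm`: E[⟪Uᵀx, Sᵀx⟫/‖x‖] = (ρ_k/k)⟪U, S⟫.

With S = U and AM-GM it bounds the support function by R_k‖U‖, where R_k is `segreRadius k`, so
C(k,m) lies in the ball. With Cauchy–Schwarz it shows that C(k,m) contains every matrix of operator
norm at most R_k/√k. For m ≥ k these include two antipodal matrices of Frobenius norm R_k, so no
smaller ball works.

For the volume, a matrix whose k rows have norm at most a and pairwise inner products at most ca² in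
absolute value has squared operator norm at most a²(1+kc). Such row tuples fill at least a fraction
c^(k²) of the product of k balls of radius a in ℝ^m (`le_volume_nearOrthogonal`). Taking c = 1/m and
a close to R_k/√k costs only a factor polynomial in m. Stirling-type bounds show that k balls of
radius R_k/√k in ℝ^m have, up to another polynomial factor, at least the volume of the ball of
radius R_k in ℝ^(km). -/

/-! ### The support function of the Segre zonoid. -/

/-- The vector `Uᵀ x`, for a `k × m` matrix `U` and `x ∈ ℝ^k`. -/
noncomputable def transposeMulVec {k m : ℕ} (U : MatSpace k m) (x : EuclideanSpace ℝ (Fin k)) :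
    EuclideanSpace ℝ (Fin m) :=
  WithLp.toLp 2 fun j => ∑ i, x i * U (i, j)

theorem continuous_transposeMulVec {k m : ℕ} (U : MatSpace k m) :
    Continuous (transposeMulVec U) := by
  unfold transposeMulVec
  fun_prop

theorem inner_outerProd {k m : ℕ} (x : EuclideanSpace ℝ (Fin k)) (y : EuclideanSpace ℝ (Fin m))
    (U : MatSpace k m) : ⟪outerProd x y, U⟫ = ⟪transposeMulVec U x, y⟫ := by
  simp only [PiLp.inner_apply, outerProd, transposeMulVec, Fintype.sum_prod_type, RCLike.inner_apply,
    conj_trivial, Finset.mul_sum]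
  rw [Finset.sum_comm]
  refine Finset.sum_congr rfl fun j _ => Finset.sum_congr rfl fun i _ => by ring

theorem inner_transposeMulVec {k m : ℕ} (U S : MatSpace k m) (x : EuclideanSpace ℝ (Fin k)) :
    ⟪transposeMulVec U x, transposeMulVec S x⟫ =
      ∑ i, ∑ i', (∑ j, U (i, j) * S (i', j)) * (x i * x i') := by
  simp only [PiLp.inner_apply, transposeMulVec, RCLike.inner_apply, conj_trivial, Finset.sum_mul,
    Finset.mul_sum]
  have : ∀ f : Fin m → Fin k → Fin k → ℝ,
      ∑ j, ∑ i, ∑ i', f j i i' = ∑ i, ∑ i', ∑ j, f j i i' := fun f => by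
    rw [Finset.sum_comm]
    simp_rw [Finset.sum_comm (s := (Finset.univ : Finset (Fin m)))]
  rw [this]
  refine Finset.sum_congr rfl fun i _ => Finset.sum_congr rfl fun i' _ =>
    Finset.sum_congr rfl fun j _ => by ring

/-- Cauchy–Schwarz for `U` against the rank-one matrix x(Uᵀx)ᵀ, divided by ‖Uᵀx‖. -/
theorem norm_transposeMulVec_le {k m : ℕ} (U : MatSpace k m) (x : EuclideanSpace ℝ (Fin k)) :
    ‖transposeMulVec U x‖ ≤ ‖U‖ * ‖x‖ := by
  have h1 := real_inner_le_norm (outerProd x (transposeMulVec U x)) U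
  rw [inner_outerProd, norm_outerProd, real_inner_self_eq_norm_mul_norm] at h1
  rcases (norm_nonneg (transposeMulVec U x)).eq_or_lt with h2 | h2
  · rw [← h2]; positivity
  · refine le_of_mul_le_mul_right ?_ h2
    linarith

theorem integral_max_zero_gaussianReal (v : NNReal) :
    ∫ t, max 0 t ∂(gaussianReal 0 v) = √v / √(2 * Real.pi) := by
  rcases eq_or_ne v 0 with rfl | hv
  · simp [gaussianReal_zero_var]
  have hv' : (0 : ℝ) < v := by positivity
  rw [integral_gaussianReal_eq_integral_smul hv]
  have h1 : (fun t : ℝ => gaussianPDFReal 0 v t • max 0 t) =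
      (Set.Ioi (0 : ℝ)).indicator (fun t => (√(2 * Real.pi * v))⁻¹ *
        (t ^ (1 : ℝ) * Real.exp (-(1 / (2 * v)) * t ^ (2 : ℝ)))) := by
    ext t
    by_cases ht : 0 < t
    · rw [Set.indicator_of_mem (Set.mem_Ioi.2 ht), max_eq_right ht.le, gaussianPDFReal, Real.rpow_one,
        Real.rpow_two, smul_eq_mul, sub_zero]
      rw [show -t ^ 2 / (2 * (v : ℝ)) = -(1 / (2 * v)) * t ^ 2 by ring]
      ring
    · rw [Set.indicator_of_notMem (by simpa using ht), max_eq_left (by linarith), smul_zero]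
  rw [h1, integral_indicator measurableSet_Ioi, integral_const_mul,
    integral_rpow_mul_exp_neg_mul_rpow (by norm_num) (by norm_num) (by positivity)]
  have h2 : √(v : ℝ) * √v = v := Real.mul_self_sqrt hv'.le
  have h3 : 0 < √(v : ℝ) := Real.sqrt_pos.2 hv'
  have h4 : (1 / (2 * (v : ℝ))) ^ (-((1 : ℝ) + 1) / 2) = 2 * (√(v : ℝ) * √v) := by
    rw [h2, show -((1 : ℝ) + 1) / 2 = -1 by norm_num, Real.rpow_neg_one, one_div, inv_inv]
  rw [h4, show ((1 : ℝ) + 1) / 2 = 1 by norm_num, Real.Gamma_one, Real.sqrt_mul (by positivity)]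
  field_simp

/-- The law of ⟪v, y⟫ is centred Gaussian with variance ‖v‖². -/
theorem integral_max_inner_stdGaussian {E : Type*} [NormedAddCommGroup E] [InnerProductSpace ℝ E]
    [FiniteDimensional ℝ E] [MeasurableSpace E] [BorelSpace E] (v : E) :
    ∫ y, max 0 ⟪v, y⟫ ∂(stdGaussian E) = ‖v‖ / √(2 * Real.pi) := by
  have h := IsGaussian.map_eq_gaussianReal (μ := stdGaussian E) (innerSL ℝ v)
  rw [integral_strongDual_stdGaussian, variance_dual_stdGaussian, innerSL_apply_norm] at h
  have h2 := integral_max_zero_gaussianReal (‖v‖ ^ 2).toNNReal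
  rw [← h, integral_map (by fun_prop) (by fun_prop), Real.coe_toNNReal _ (by positivity),
    Real.sqrt_sq (norm_nonneg v)] at h2
  exact h2

/-- The support function of the Segre zonoid. -/
theorem integral_supportFn_outerProd {k m : ℕ} (U : MatSpace k m) :
    ∫ p, supportFn (segment ℝ 0 (outerProd p.1 p.2)) U
          ∂((stdGaussian (EuclideanSpace ℝ (Fin k))).prod
            (stdGaussian (EuclideanSpace ℝ (Fin m)))) =
      (∫ x, ‖transposeMulVec U x‖ ∂(stdGaussian (EuclideanSpace ℝ (Fin k)))) /
        √(2 * Real.pi) := by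
  simp only [supportFn_segment]
  have h : Integrable (fun p : EuclideanSpace ℝ (Fin k) × EuclideanSpace ℝ (Fin m) =>
      max 0 ⟪outerProd p.1 p.2, U⟫) ((stdGaussian (EuclideanSpace ℝ (Fin k))).prod
        (stdGaussian (EuclideanSpace ℝ (Fin m)))) :=
    (integrable_zero _ _ _).sup ((integrable_outerProd k m).inner_const U)
  rw [integral_prod _ h]
  simp only [inner_outerProd, integral_max_inner_stdGaussian, integral_div]

/-! ### Isotropy of the Gaussian with weight 1/‖x‖. -/

theorem integral_comp_isometryEquiv_stdGaussian {E F : Type*} [NormedAddCommGroup E]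
    [InnerProductSpace ℝ E] [FiniteDimensional ℝ E] [MeasurableSpace E] [BorelSpace E]
    [NormedAddCommGroup F] [NormedSpace ℝ F] (e : E ≃ₗᵢ[ℝ] E) (f : E → F) :
    ∫ x, f (e x) ∂(stdGaussian E) = ∫ x, f x ∂(stdGaussian E) := by
  conv_rhs => rw [← stdGaussian_map e]
  exact (integral_map_equiv e.toHomeomorph.toMeasurableEquiv f).symm

theorem integrable_norm_stdGaussian (k : ℕ) :
    Integrable (fun x => ‖x‖) (stdGaussian (EuclideanSpace ℝ (Fin k))) :=
  (IsGaussian.integrable_id (μ := stdGaussian (EuclideanSpace ℝ (Fin k)))).norm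

theorem integrable_mul_div_norm {k : ℕ} (i i' : Fin k) :
    Integrable (fun x : EuclideanSpace ℝ (Fin k) => x i * x i' / ‖x‖)
      (stdGaussian (EuclideanSpace ℝ (Fin k))) := by
  refine (integrable_norm_stdGaussian k).mono'
    (Measurable.aestronglyMeasurable (by fun_prop)) (Eventually.of_forall fun x => ?_)
  rcases (norm_nonneg x).eq_or_lt with h | h
  · simp [← h]
  rw [norm_div, norm_mul, norm_norm, div_le_iff₀ h]
  exact mul_le_mul (PiLp.norm_apply_le x i) (PiLp.norm_apply_le x i') (norm_nonneg _) h.le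

/-- Flipping the sign of coordinate `i` preserves the Gaussian and the norm but negates the
integrand. -/
theorem integral_mul_div_norm_of_ne {k : ℕ} {i i' : Fin k} (h : i ≠ i') :
    ∫ x, x i * x i' / ‖x‖ ∂(stdGaussian (EuclideanSpace ℝ (Fin k))) = 0 := by
  let e : EuclideanSpace ℝ (Fin k) ≃ₗᵢ[ℝ] EuclideanSpace ℝ (Fin k) :=
    LinearIsometryEquiv.piLpCongrRight 2 fun l =>
      if l = i then LinearIsometryEquiv.neg ℝ else LinearIsometryEquiv.refl ℝ ℝ
  have h1 := integral_comp_isometryEquiv_stdGaussian e (fun x => x i * x i' / ‖x‖)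
  have h2 : ∀ x, (e x) i = -x i := fun x => by simp [e]
  have h3 : ∀ x, (e x) i' = x i' := fun x => by simp [e, h.symm]
  simp only [h2, h3, LinearIsometryEquiv.norm_map, neg_mul, neg_div, integral_neg] at h1
  linarith

/-- Swapping coordinates shows that the k integrals agree; they add up to E‖x‖. -/
theorem integral_sq_div_norm {k : ℕ} (i : Fin k) :
    ∫ x, x i * x i / ‖x‖ ∂(stdGaussian (EuclideanSpace ℝ (Fin k))) = gaussRho k / k := by
  have h1 : ∀ l : Fin k, ∫ x, x l * x l / ‖x‖ ∂(stdGaussian (EuclideanSpace ℝ (Fin k))) =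
      ∫ x, x i * x i / ‖x‖ ∂(stdGaussian (EuclideanSpace ℝ (Fin k))) := fun l => by
    have h2 := integral_comp_isometryEquiv_stdGaussian
      (LinearIsometryEquiv.piLpCongrLeft 2 ℝ ℝ (Equiv.swap i l) :
        EuclideanSpace ℝ (Fin k) ≃ₗᵢ[ℝ] EuclideanSpace ℝ (Fin k)) (fun x => x i * x i / ‖x‖)
    rw [← h2]
    simp [LinearIsometryEquiv.piLpCongrLeft_apply, Equiv.piCongrLeft'_apply]
  have h3 : ∑ l, ∫ x, x l * x l / ‖x‖ ∂(stdGaussian (EuclideanSpace ℝ (Fin k))) = gaussRho k := by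
    rw [← integral_finsetSum _ fun l _ => integrable_mul_div_norm l l, gaussRho]
    congr 1
    ext x
    rw [← Finset.sum_div]
    have h4 : ∑ l, x l * x l = ‖x‖ * ‖x‖ := by
      rw [← real_inner_self_eq_norm_mul_norm, PiLp.inner_apply]
      rfl
    rw [h4, mul_self_div_self]
  rw [Finset.sum_congr rfl fun l _ => h1 l] at h3
  have hk : (k : ℝ) ≠ 0 := by
    have := i.pos
    positivity
  rw [← h3]
  simp
  field_simp

theorem inner_transposeMulVec_div_norm {k m : ℕ} (U S : MatSpace k m)
    (x : EuclideanSpace ℝ (Fin k)) :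
    ⟪transposeMulVec U x, transposeMulVec S x⟫ / ‖x‖ =
      ∑ i, ∑ i', (∑ j, U (i, j) * S (i', j)) * (x i * x i' / ‖x‖) := by
  simp only [inner_transposeMulVec, Finset.sum_div, mul_div_assoc]

theorem integrable_inner_transposeMulVec_div_norm {k m : ℕ} (U S : MatSpace k m) :
    Integrable (fun x => ⟪transposeMulVec U x, transposeMulVec S x⟫ / ‖x‖)
      (stdGaussian (EuclideanSpace ℝ (Fin k))) := by
  simp only [inner_transposeMulVec_div_norm]
  exact integrable_finsetSum _ fun i _ => integrable_finsetSum _ fun i' _ =>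
    (integrable_mul_div_norm i i').const_mul _

/-- E[xxᵀ/‖x‖] is ρ_k/k times the identity. The weight 1/‖x‖ makes the integrand homogeneous of
degree one, which is why ρ_k appears. -/
theorem integral_inner_transposeMulVec_div_norm {k m : ℕ} (U S : MatSpace k m) :
    ∫ x, ⟪transposeMulVec U x, transposeMulVec S x⟫ / ‖x‖
      ∂(stdGaussian (EuclideanSpace ℝ (Fin k))) = gaussRho k / k * ⟪U, S⟫ := by
  simp only [inner_transposeMulVec_div_norm]
  rw [integral_finsetSum _ fun i _ => integrable_finsetSum _ fun i' _ =>
    (integrable_mul_div_norm i i').const_mul _]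
  have h1 : ∀ i : Fin k, ∫ x, ∑ i', (∑ j, U (i, j) * S (i', j)) * (x i * x i' / ‖x‖)
      ∂(stdGaussian (EuclideanSpace ℝ (Fin k))) =
      gaussRho k / k * ∑ j, U (i, j) * S (i, j) := fun i => by
    rw [integral_finsetSum _ fun i' _ => (integrable_mul_div_norm i i').const_mul _]
    simp only [integral_const_mul]
    rw [Finset.sum_eq_single i]
    · rw [integral_sq_div_norm]; ring
    · intro i' _ hi'
      rw [integral_mul_div_norm_of_ne hi'.symm, mul_zero]
    · simp
  simp only [h1, ← Finset.mul_sum, PiLp.inner_apply, Fintype.sum_prod_type]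
  simp [mul_comm]

/-! ### Volume of the set of nearly orthogonal tuples. -/

section
variable {E : Type*} [NormedAddCommGroup E] [InnerProductSpace ℝ E]

/-- The symmetric map acting as `c` on `K` and as the identity on `Kᗮ`. -/
noncomputable def scaleOn [FiniteDimensional ℝ E] (K : Submodule ℝ E) (c : ℝ) : E →ₗ[ℝ] E :=
  LinearMap.id + (c - 1) • K.starProjection.toLinearMap

theorem scaleOn_apply [FiniteDimensional ℝ E] (K : Submodule ℝ E) (c : ℝ) (v : E) :
    scaleOn K c v = v + (c - 1) • K.starProjection v := rfl

theorem inner_scaleOn_of_mem [FiniteDimensional ℝ E] (K : Submodule ℝ E) (c : ℝ) (v : E)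
    {w : E} (hw : w ∈ K) : ⟪scaleOn K c v, w⟫ = c * ⟪v, w⟫ := by
  rw [scaleOn_apply, inner_add_left, real_inner_smul_left, K.inner_starProjection_left_eq_right,
    Submodule.starProjection_eq_self_iff.2 hw]
  ring

theorem norm_scaleOn_le [FiniteDimensional ℝ E] (K : Submodule ℝ E) {c : ℝ} (hc0 : 0 ≤ c)
    (hc1 : c ≤ 1) (v : E) : ‖scaleOn K c v‖ ≤ ‖v‖ := by
  -- A convex combination of `v` and its projection to `Kᗮ`, neither longer than `v`.
  have h : scaleOn K c v = c • v + (1 - c) • Kᗮ.starProjection v := by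
    rw [Submodule.starProjection_orthogonal, scaleOn_apply]
    simp only [sub_apply, ContinuousLinearMap.id_apply]
    module
  rw [h]
  refine (norm_add_le _ _).trans ?_
  rw [norm_smul, norm_smul, Real.norm_of_nonneg hc0, Real.norm_of_nonneg (by linarith)]
  nlinarith [Kᗮ.norm_starProjection_apply_le v, norm_nonneg v]

theorem det_scaleOn [FiniteDimensional ℝ E] (K : Submodule ℝ E) (c : ℝ) :
    LinearMap.det (scaleOn K c) = c ^ Module.finrank ℝ K := by
  let e := K.prodEquivOfIsCompl _ K.isCompl_orthogonal
  have h : (e : _ →ₗ[ℝ] E) ∘ₗ ((c • LinearMap.id : K →ₗ[ℝ] K).prodMap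
      (LinearMap.id : Kᗮ →ₗ[ℝ] Kᗮ)) ∘ₗ (e.symm : E →ₗ[ℝ] _) = scaleOn K c := by
    ext v
    obtain ⟨⟨a, b⟩, rfl⟩ := e.surjective v
    have ha : K.starProjection (a : E) = a := Submodule.starProjection_eq_self_iff.2 a.2
    have hb : K.starProjection (b : E) = 0 := K.starProjection_apply_eq_zero_iff.2 b.2
    simp only [LinearMap.comp_apply, LinearEquiv.coe_coe,
      scaleOn_apply, e, Submodule.coe_prodEquivOfIsCompl', LinearMap.prodMap_apply, map_add, ha, hb]
    simp
    module
  rw [← h, LinearMap.det_conj, LinearMap.det_prodMap, LinearMap.det_smul, LinearMap.det_id,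
    LinearMap.det_id, mul_one, mul_one]

/-- Slabs orthogonal to finitely many vectors cut out a large part of a ball. -/
theorem le_volume_closedBall_inter_slabs [FiniteDimensional ℝ E] [MeasurableSpace E]
    [BorelSpace E] {n : ℕ} (s : Fin n → E) {a c : ℝ} (ha : ∀ i, ‖s i‖ ≤ a) (hc0 : 0 < c)
    (hc1 : c ≤ 1) :
    ENNReal.ofReal (c ^ n) * volume (Metric.closedBall (0 : E) a) ≤
      volume {v : E | ‖v‖ ≤ a ∧ ∀ i, |⟪v, s i⟫| ≤ c * a ^ 2} := by
  let K := Submodule.span ℝ (Set.range s)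
  have hK : Module.finrank ℝ K ≤ n :=
    (finrank_range_le_card s).trans_eq (Fintype.card_fin n)
  -- Shrinking by `c` along the span of the `s i` scales every ⟪v, s i⟫ by `c`, so the shrunken ball
  -- lies in all the slabs. Its volume drops by c^(dim K), and dim K ≤ n.
  have h1 : scaleOn K c '' Metric.closedBall (0 : E) a ⊆
      {v : E | ‖v‖ ≤ a ∧ ∀ i, |⟪v, s i⟫| ≤ c * a ^ 2} := by
    rintro _ ⟨v, hv, rfl⟩
    rw [mem_closedBall_zero_iff] at hv
    refine ⟨(norm_scaleOn_le K hc0.le hc1 v).trans hv, fun i => ?_⟩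
    rw [inner_scaleOn_of_mem K c v (Submodule.subset_span ⟨i, rfl⟩), abs_mul, abs_of_pos hc0]
    have h2 := (abs_real_inner_le_norm v (s i)).trans
      (mul_le_mul hv (ha i) (norm_nonneg _) ((norm_nonneg v).trans hv))
    rw [sq]
    gcongr
  refine le_trans ?_ (measure_mono h1)
  rw [Measure.addHaar_image_linearMap, det_scaleOn, abs_of_nonneg (by positivity)]
  gcongr ENNReal.ofReal ?_ * _
  exact pow_le_pow_of_le_one hc0.le hc1 hK

/-- The `n`-tuples of vectors of norm at most `a` which are orthogonal up to `c * a ^ 2`. -/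
def nearOrthogonal (E : Type*) [NormedAddCommGroup E] [InnerProductSpace ℝ E] (n : ℕ) (a c : ℝ) :
    Set (Fin n → E) :=
  {s | (∀ i, ‖s i‖ ≤ a) ∧ ∀ i j, i ≠ j → |⟪s i, s j⟫| ≤ c * a ^ 2}

theorem isClosed_nearOrthogonal (n : ℕ) (a c : ℝ) : IsClosed (nearOrthogonal E n a c) := by
  simp only [nearOrthogonal, Set.ofPred_and, Set.ofPred_forall]
  refine IsClosed.inter (isClosed_iInter fun i => isClosed_le (by fun_prop) (by fun_prop))
    (isClosed_iInter fun i => isClosed_iInter fun j => isClosed_iInter fun _ =>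
      isClosed_le (by fun_prop) (by fun_prop))

theorem cons_mem_nearOrthogonal {n : ℕ} {a c : ℝ} {s : Fin n → E} {v : E}
    (hs : s ∈ nearOrthogonal E n a c) (hv : ‖v‖ ≤ a) (hvs : ∀ i, |⟪v, s i⟫| ≤ c * a ^ 2) :
    (Fin.cons v s : Fin (n + 1) → E) ∈ nearOrthogonal E (n + 1) a c := by
  refine ⟨fun i => ?_, fun i j hij => ?_⟩
  · cases i using Fin.cases with
    | zero => exact hv
    | succ i => exact hs.1 i
  · cases i using Fin.cases with
    | zero =>
      cases j using Fin.cases with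
      | zero => exact absurd rfl hij
      | succ j => exact hvs j
    | succ i =>
      cases j using Fin.cases with
      | zero => rw [real_inner_comm]; exact hvs i
      | succ j => exact hs.2 i j fun h => hij (congrArg _ h)

/-- Vectors are added one at a time by Fubini, each confined to the slabs of the previous ones. The
fixed exponent `N` replaces the varying number of slabs, so that the bound is a pure power. -/
theorem le_volume_nearOrthogonal [FiniteDimensional ℝ E] [MeasurableSpace E] [BorelSpace E]
    (n N : ℕ) (hn : n ≤ N) {a c : ℝ} (hc0 : 0 < c) (hc1 : c ≤ 1) :
    (ENNReal.ofReal (c ^ N) * volume (Metric.closedBall (0 : E) a)) ^ n ≤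
      volume (nearOrthogonal E n a c) := by
  induction n with
  | zero =>
    have : nearOrthogonal E 0 a c = Set.univ := by
      ext s
      simp [nearOrthogonal]
    rw [this, pow_zero]
    simp [volume_pi]
  | succ n ih =>
    have hmeas := (isClosed_nearOrthogonal (E := E) (n + 1) a c).measurableSet
    let e := MeasurableEquiv.piFinSuccAbove (fun _ : Fin (n + 1) => E) 0
    have he : MeasurePreserving e.symm :=
      (volume_preserving_piFinSuccAbove (fun _ : Fin (n + 1) => E) 0).symm
    rw [← he.measure_preimage hmeas.nullMeasurableSet, Measure.volume_eq_prod,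
      Measure.prod_apply_symm (e.symm.measurable hmeas)]
    have hn' := (isClosed_nearOrthogonal (E := E) n a c).measurableSet
    calc (ENNReal.ofReal (c ^ N) * volume (Metric.closedBall (0 : E) a)) ^ (n + 1)
        ≤ (ENNReal.ofReal (c ^ N) * volume (Metric.closedBall (0 : E) a)) *
            volume (nearOrthogonal E n a c) := by
          rw [pow_succ']
          gcongr
          exact ih (by omega)
      _ = ∫⁻ s in nearOrthogonal E n a c,
            (ENNReal.ofReal (c ^ N) * volume (Metric.closedBall (0 : E) a)) := by
          rw [setLIntegral_const]
      _ ≤ ∫⁻ s in nearOrthogonal E n a c, volume ((fun v => (v, s)) ⁻¹'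
            (e.symm ⁻¹' nearOrthogonal E (n + 1) a c)) := by
          refine setLIntegral_mono' hn' fun s hs => ?_
          refine le_trans ?_ ((le_volume_closedBall_inter_slabs s hs.1 hc0 hc1).trans
            (measure_mono fun v hv => ?_))
          · gcongr ENNReal.ofReal ?_ * _
            exact pow_le_pow_of_le_one hc0.le hc1 (by omega)
          · have := cons_mem_nearOrthogonal hs hv.1 hv.2
            simpa [e, MeasurableEquiv.piFinSuccAbove, Fin.insertNthEquiv] using this
      _ ≤ _ := setLIntegral_le_lintegral _ _

/-- Expand the square and use |x_i x_j| ≤ (x_i² + x_j²)/2 off the diagonal. The off-diagonal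
allowance is also granted on the diagonal, hence n·c rather than (n-1)·c. -/
theorem norm_sum_smul_le_of_mem_nearOrthogonal {n : ℕ} {a c : ℝ} {s : Fin n → E} (hc : 0 ≤ c)
    (hs : s ∈ nearOrthogonal E n a c) (x : EuclideanSpace ℝ (Fin n)) :
    ‖∑ i, x i • s i‖ ^ 2 ≤ a ^ 2 * (1 + n * c) * ‖x‖ ^ 2 := by
  have hx : ‖x‖ ^ 2 = ∑ i, x i ^ 2 := by
    rw [EuclideanSpace.norm_sq_eq]
    simp
  have h1 : ∀ i j, x i * x j * ⟪s i, s j⟫ ≤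
      (if i = j then a ^ 2 * x i ^ 2 else 0) + c * a ^ 2 * ((x i ^ 2 + x j ^ 2) / 2) := by
    intro i j
    have h0 : 0 ≤ c * a ^ 2 * ((x i ^ 2 + x j ^ 2) / 2) := by positivity
    split_ifs with hij
    · subst hij
      rw [real_inner_self_eq_norm_sq]
      have h2 : ‖s i‖ ^ 2 ≤ a ^ 2 := by
        have := hs.1 i
        gcongr
      nlinarith [mul_le_mul_of_nonneg_left h2 (sq_nonneg (x i))]
    · rw [zero_add]
      calc x i * x j * ⟪s i, s j⟫ ≤ |x i * x j * ⟪s i, s j⟫| := le_abs_self _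
        _ = |x i * x j| * |⟪s i, s j⟫| := abs_mul _ _
        _ ≤ ((x i ^ 2 + x j ^ 2) / 2) * (c * a ^ 2) := by
          gcongr
          · rw [abs_le]
            constructor <;> nlinarith [sq_nonneg (x i + x j), sq_nonneg (x i - x j)]
          · exact hs.2 i j hij
        _ = _ := mul_comm _ _
  calc ‖∑ i, x i • s i‖ ^ 2 = ∑ i, ∑ j, x i * x j * ⟪s i, s j⟫ := by
        rw [← real_inner_self_eq_norm_sq, sum_inner]
        refine Finset.sum_congr rfl fun i _ => ?_
        rw [inner_sum]
        refine Finset.sum_congr rfl fun j _ => ?_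
        rw [real_inner_smul_left, real_inner_smul_right, mul_assoc]
    _ ≤ ∑ i, ∑ j, ((if i = j then a ^ 2 * x i ^ 2 else 0) +
          c * a ^ 2 * ((x i ^ 2 + x j ^ 2) / 2)) :=
        Finset.sum_le_sum fun i _ => Finset.sum_le_sum fun j _ => h1 i j
    _ = a ^ 2 * (1 + n * c) * ‖x‖ ^ 2 := by
        rw [hx]
        simp only [Finset.sum_add_distrib, ← Finset.mul_sum, ← Finset.sum_div, Finset.sum_ite_eq,
          Finset.mem_univ, if_true, Finset.sum_const, Finset.card_univ, Fintype.card_fin,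
          nsmul_eq_mul]
        ring

end

/-! ### Stirling-type bounds up to polynomial factors. -/

/-- Keep only t > x in the Gamma integral, where t^x ≥ x^x. -/
theorem rpow_self_mul_exp_neg_le_Gamma {x : ℝ} (hx : 0 < x) :
    x ^ x * Real.exp (-x) ≤ Real.Gamma (x + 1) := by
  rw [Real.Gamma_eq_integral (by linarith), ← integral_exp_neg_Ioi x, ← integral_const_mul]
  have hint := Real.GammaIntegral_convergent (s := x + 1) (by linarith)
  calc ∫ t in Set.Ioi x, x ^ x * Real.exp (-t)
      ≤ ∫ t in Set.Ioi x, Real.exp (-t) * t ^ (x + 1 - 1) := by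
        refine setIntegral_mono_on ((integrableOn_exp_neg_Ioi x).const_mul _)
          (hint.mono_set (Set.Ioi_subset_Ioi hx.le)) measurableSet_Ioi fun t ht => ?_
        rw [mul_comm, add_sub_cancel_right]
        gcongr
        exact (Set.mem_Ioi.1 ht).le
    _ ≤ _ := setIntegral_mono_set hint
        ((ae_restrict_iff' measurableSet_Ioi).2 (Eventually.of_forall fun t ht => by
          have : 0 < t := ht
          positivity)) (Set.Ioi_subset_Ioi hx.le).eventuallyLE

/-- The step of an induction proving `Γ (x + 1) ≤ C x (x / e) ^ x`. -/
theorem Gamma_add_one_le_step {x C : ℝ} (hx : 0 < x) (hC : 0 ≤ C)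
    (h : Real.Gamma (x + 1) ≤ C * (x * (x ^ x * Real.exp (-x)))) :
    Real.Gamma (x + 1 + 1) ≤ C * ((x + 1) * ((x + 1) ^ (x + 1) * Real.exp (-(x + 1)))) := by
  rw [Real.Gamma_add_one (by linarith)]
  -- This is (1 + 1/x)^(x+1) ≥ e, from log t ≥ 1 - 1/t at t = (x+1)/x.
  have h1 : Real.exp 1 * x ^ (x + 1) ≤ (x + 1) ^ (x + 1) := by
    have h2 : 1 ≤ (x + 1) * Real.log ((x + 1) / x) := by
      have h3 := Real.one_sub_inv_le_log_of_pos (x := (x + 1) / x) (by positivity)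
      have h4 : 1 = (x + 1) * (1 - ((x + 1) / x)⁻¹) := by field_simp; ring
      calc (1 : ℝ) = (x + 1) * (1 - ((x + 1) / x)⁻¹) := h4
        _ ≤ _ := by gcongr
    rw [Real.log_div (by linarith) hx.ne'] at h2
    rw [Real.rpow_def_of_pos hx, Real.rpow_def_of_pos (by linarith : 0 < x + 1), ← Real.exp_add,
      Real.exp_le_exp]
    linarith
  have h5 : x * x ^ x = x ^ (x + 1) := by rw [Real.rpow_add_one hx.ne', mul_comm]
  have h6 : Real.exp (-x) = Real.exp 1 * Real.exp (-(x + 1)) := by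
    rw [← Real.exp_add]; ring_nf
  calc (x + 1) * Real.Gamma (x + 1) ≤ (x + 1) * (C * (x * (x ^ x * Real.exp (-x)))) := by gcongr
    _ = C * ((x + 1) * ((Real.exp 1 * x ^ (x + 1)) * Real.exp (-(x + 1)))) := by
      rw [h6, ← h5]; ring
    _ ≤ _ := by gcongr

/-- Raising x = n/2 by one raises n by two, so n = 1 and n = 2 are both base cases; the constant is
the sum of their two ratios. -/
theorem exists_Gamma_half_le : ∃ C : ℝ, 0 < C ∧ ∀ n : ℕ, 1 ≤ n →
    Real.Gamma ((n : ℝ) / 2 + 1) ≤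
      C * ((n : ℝ) / 2 * (((n : ℝ) / 2) ^ ((n : ℝ) / 2) * Real.exp (-((n : ℝ) / 2)))) := by
  have hpos : ∀ x : ℝ, 0 < x → 0 < x * (x ^ x * Real.exp (-x)) := fun x hx => by positivity
  let f : ℝ → ℝ := fun x => Real.Gamma (x + 1) / (x * (x ^ x * Real.exp (-x)))
  have hf : ∀ x : ℝ, 0 < x → 0 < f x := fun x hx =>
    div_pos (Real.Gamma_pos_of_pos (by linarith)) (hpos x hx)
  have hf1 := hf 1 one_pos
  have hf2 := hf (1 / 2) (by norm_num)
  have base : ∀ x : ℝ, 0 < x → f x ≤ f 1 + f (1 / 2) →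
      Real.Gamma (x + 1) ≤ (f 1 + f (1 / 2)) * (x * (x ^ x * Real.exp (-x))) := fun x hx h =>
    (div_le_iff₀ (hpos x hx)).1 h
  refine ⟨f 1 + f (1 / 2), by positivity, fun n hn => ?_⟩
  induction n using Nat.strong_induction_on with
  | _ n ih =>
    match n, hn with
    | 1, _ => simpa using base (1 / 2) (by norm_num) (by linarith)
    | 2, _ => simpa using base 1 one_pos (by linarith)
    | n + 3, _ =>
      have h := Gamma_add_one_le_step (by positivity) (by positivity)
        (ih (n + 1) (by omega) (by omega))
      have h' : ((n + 1 : ℕ) : ℝ) / 2 + 1 = ((n + 3 : ℕ) : ℝ) / 2 := by push_cast; ring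
      rwa [h'] at h

/-! ### The zonoid between an operator-norm ball and a Frobenius ball. -/

theorem integrable_norm_transposeMulVec {k m : ℕ} (U : MatSpace k m) :
    Integrable (fun x => ‖transposeMulVec U x‖) (stdGaussian (EuclideanSpace ℝ (Fin k))) := by
  refine ((integrable_norm_stdGaussian k).const_mul ‖U‖).mono'
    (continuous_transposeMulVec U).norm.aestronglyMeasurable (Eventually.of_forall fun x => ?_)
  rw [norm_norm]
  exact norm_transposeMulVec_le U x

theorem gaussRho_pos {k : ℕ} (hk : 1 ≤ k) : 0 < gaussRho k := by
  let v : EuclideanSpace ℝ (Fin k) := EuclideanSpace.single ⟨0, hk⟩ 1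
  have hv : ‖v‖ = 1 := by simp [v]
  have h1 := integral_max_inner_stdGaussian v
  have h2 : ∫ y, max 0 ⟪v, y⟫ ∂(stdGaussian (EuclideanSpace ℝ (Fin k))) ≤ gaussRho k := by
    refine integral_mono_of_nonneg (Eventually.of_forall fun y => le_max_left _ _)
      (integrable_norm_stdGaussian k) (Eventually.of_forall fun y => ?_)
    refine max_le (norm_nonneg y) ((real_inner_le_norm v y).trans ?_)
    rw [hv, one_mul]
  rw [h1, hv] at h2
  exact lt_of_lt_of_le (by positivity) h2

theorem mem_segreZonoid {k m : ℕ} (S : MatSpace k m) :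
    S ∈ segreZonoid k m ↔ ∀ U : MatSpace k m,
      ⟪S, U⟫ ≤ (∫ x, ‖transposeMulVec U x‖ ∂(stdGaussian (EuclideanSpace ℝ (Fin k)))) /
        √(2 * Real.pi) := by
  simp only [← integral_supportFn_outerProd]
  rfl

theorem integral_norm_transposeMulVec_le {k m : ℕ} (hk : 1 ≤ k) (U : MatSpace k m) :
    ∫ x, ‖transposeMulVec U x‖ ∂(stdGaussian (EuclideanSpace ℝ (Fin k))) ≤
      gaussRho k / √k * ‖U‖ := by
  have hk' : (0 : ℝ) < k := by positivity
  rcases (norm_nonneg U).eq_or_lt with hU | hU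
  · rw [← hU, mul_zero]
    refine integral_nonpos fun x => ?_
    have := norm_transposeMulVec_le U x
    rwa [← hU, zero_mul] at this
  have hs : 0 < √(k : ℝ) := Real.sqrt_pos.2 hk'
  have hsk : √(k : ℝ) * √k = k := Real.mul_self_sqrt hk'.le
  -- AM-GM, with coefficients chosen so that both terms integrate to half of the claimed bound.
  have key : ∀ x, ‖transposeMulVec U x‖ ≤ ‖U‖ / (2 * √k) * ‖x‖ +
      √k / (2 * ‖U‖) * (⟪transposeMulVec U x, transposeMulVec U x⟫ / ‖x‖) := fun x => by
    rw [real_inner_self_eq_norm_mul_norm]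
    rcases (norm_nonneg x).eq_or_lt with hx | hx
    · have := norm_transposeMulVec_le U x
      simpa [← hx] using this
    · have h1 : ‖U‖ / (2 * √k) * ‖x‖ + √k / (2 * ‖U‖) *
          (‖transposeMulVec U x‖ * ‖transposeMulVec U x‖ / ‖x‖) - ‖transposeMulVec U x‖ =
          (‖U‖ * ‖x‖ - √k * ‖transposeMulVec U x‖) ^ 2 / (2 * √k * ‖U‖ * ‖x‖) := by
        field_simp
        ring
      have h2 : 0 ≤ (‖U‖ * ‖x‖ - √k * ‖transposeMulVec U x‖) ^ 2 / (2 * √k * ‖U‖ * ‖x‖) := by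
        positivity
      linarith
  have hi := (integrable_norm_stdGaussian k).const_mul (‖U‖ / (2 * √k))
  have hi' := (integrable_inner_transposeMulVec_div_norm U U).const_mul (√k / (2 * ‖U‖))
  refine (integral_mono (integrable_norm_transposeMulVec U) (hi.add hi') key).trans_eq ?_
  rw [integral_add' hi hi', integral_const_mul, integral_const_mul,
    integral_inner_transposeMulVec_div_norm, real_inner_self_eq_norm_mul_norm, ← gaussRho]
  nth_rw 3 [← hsk]
  field_simp
  ring

theorem segreRadius_eq (k : ℕ) :
    segreRadius k = gaussRho k / √k / √(2 * Real.pi) := by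
  rw [segreRadius, Real.sqrt_mul (by positivity), div_div, mul_comm]

theorem segreRadius_pos {k : ℕ} (hk : 1 ≤ k) : 0 < segreRadius k := by
  have := gaussRho_pos hk
  have : (0 : ℝ) < k := by positivity
  unfold segreRadius
  positivity

/-- Testing `S` against the direction `S` itself gives ‖S‖² ≤ R_k‖S‖. -/
theorem segreZonoid_subset_segreBall {k : ℕ} (hk : 1 ≤ k) (m : ℕ) :
    segreZonoid k m ⊆ segreBall k m := by
  intro S hS
  rw [segreBall, mem_closedBall_zero_iff]
  have h1 := (mem_segreZonoid S).1 hS S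
  have h2 := div_le_div_of_nonneg_right (integral_norm_transposeMulVec_le hk S)
    (Real.sqrt_nonneg (2 * Real.pi))
  rw [mul_div_right_comm, ← segreRadius_eq] at h2
  rw [real_inner_self_eq_norm_mul_norm] at h1
  rcases (norm_nonneg S).eq_or_lt with h | h
  · rw [← h]; exact (segreRadius_pos hk).le
  · exact le_of_mul_le_mul_right (h1.trans h2) h

/-- The Segre zonoid contains every matrix of operator norm at most `segreRadius k / √k`. -/
theorem mem_segreZonoid_of_norm_transposeMulVec_le {k m : ℕ} (hk : 1 ≤ k) {S : MatSpace k m}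
    (hS : ∀ x, ‖transposeMulVec S x‖ ≤ segreRadius k / √k * ‖x‖) : S ∈ segreZonoid k m := by
  refine (mem_segreZonoid S).2 fun U => ?_
  have hk' : (0 : ℝ) < k := by positivity
  have hsk : √(k : ℝ) * √k = k := Real.mul_self_sqrt hk'.le
  -- The isotropy identity turns ⟪U, S⟫ into an average, to which Cauchy–Schwarz applies for each
  -- `x`.
  have h1 : gaussRho k / k * ⟪U, S⟫ ≤ segreRadius k / √k *
      ∫ x, ‖transposeMulVec U x‖ ∂(stdGaussian (EuclideanSpace ℝ (Fin k))) := by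
    rw [← integral_inner_transposeMulVec_div_norm, ← integral_const_mul]
    refine integral_mono (integrable_inner_transposeMulVec_div_norm U S)
      ((integrable_norm_transposeMulVec U).const_mul _) fun x => ?_
    have hr : 0 ≤ segreRadius k / √k := by
      have := segreRadius_pos hk
      positivity
    refine div_le_of_le_mul₀ (norm_nonneg x) (by positivity) ?_
    calc _ ≤ ‖transposeMulVec U x‖ * ‖transposeMulVec S x‖ := real_inner_le_norm _ _
      _ ≤ ‖transposeMulVec U x‖ * (segreRadius k / √k * ‖x‖) := by gcongr; exact hS x
      _ = _ := by ring
  have hρ := gaussRho_pos hk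
  rw [segreRadius_eq, div_right_comm, div_div (gaussRho k), hsk,
    div_mul_eq_mul_div _ (√(2 * Real.pi)), mul_div_assoc _ _ (√(2 * Real.pi))] at h1
  rw [real_inner_comm]
  exact le_of_mul_le_mul_left h1 (by positivity)

/-! ### Minimality of the ball and positivity of the volume. -/

/-- The `k × m` matrix with entries `1` on the diagonal and `0` elsewhere. -/
noncomputable def diagOne (k m : ℕ) : MatSpace k m :=
  WithLp.toLp 2 fun p => if (p.1 : ℕ) = p.2 then 1 else 0

theorem transposeMulVec_diagOne {k m : ℕ} (x : EuclideanSpace ℝ (Fin k)) (j : Fin m) :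
    transposeMulVec (diagOne k m) x j = if h : (j : ℕ) < k then x ⟨j, h⟩ else 0 := by
  simp only [transposeMulVec, diagOne, mul_ite, mul_one, mul_zero]
  split_ifs with h
  · rw [Finset.sum_eq_single ⟨j, h⟩]
    · simp
    · intro i _ hi
      exact if_neg fun h' => hi (Fin.ext h')
    · simp
  · exact Finset.sum_eq_zero fun i _ => if_neg fun h' : (i : ℕ) = j => h (by omega)

theorem norm_transposeMulVec_diagOne {k m : ℕ} (h : k ≤ m) (x : EuclideanSpace ℝ (Fin k)) :
    ‖transposeMulVec (diagOne k m) x‖ = ‖x‖ := by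
  rw [EuclideanSpace.norm_eq, EuclideanSpace.norm_eq]
  congr 1
  simp only [transposeMulVec_diagOne]
  symm
  refine Finset.sum_of_injOn (Fin.castLE h) (Fin.castLE_injective h).injOn (by simp) ?_ ?_
  · intro j _ hj
    rw [dif_neg, norm_zero, zero_pow two_ne_zero]
    intro hjk
    exact hj ⟨⟨j, hjk⟩, by simp, rfl⟩
  · intro i _
    simp

theorem norm_diagOne {k m : ℕ} (h : k ≤ m) : ‖diagOne k m‖ = √k := by
  rw [EuclideanSpace.norm_eq, Fintype.sum_prod_type]
  congr 1
  have : ∀ i : Fin k, ∑ j, ‖diagOne k m (i, j)‖ ^ 2 = 1 := fun i => by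
    rw [Finset.sum_eq_single (Fin.castLE h i)]
    · simp [diagOne]
    · intro j _ hj
      have : (i : ℕ) ≠ j := fun h' => hj (Fin.ext h'.symm)
      simp [diagOne, this]
    · simp
  simp only [this, Finset.sum_const, Finset.card_univ, Fintype.card_fin, nsmul_eq_mul, mul_one]

theorem transposeMulVec_smul {k m : ℕ} (c : ℝ) (S : MatSpace k m) (x : EuclideanSpace ℝ (Fin k)) :
    transposeMulVec (c • S) x = c • transposeMulVec S x := by
  ext j
  simp [transposeMulVec, Finset.mul_sum, mul_left_comm]

theorem smul_diagOne_mem_segreZonoid {k m : ℕ} (hk : 1 ≤ k) (h : k ≤ m) {c : ℝ}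
    (hc : |c| = segreRadius k / √k) : c • diagOne k m ∈ segreZonoid k m := by
  refine mem_segreZonoid_of_norm_transposeMulVec_le hk fun x => ?_
  rw [transposeMulVec_smul, norm_smul, norm_transposeMulVec_diagOne h, Real.norm_eq_abs, hc]

/-- The points ±(R_k/√k)·`diagOne k m` lie in the zonoid at distance 2R_k, since `diagOne k m` has
norm √k. -/
theorem segreRadius_le_of_subset_closedBall {k m : ℕ} (hk : 1 ≤ k) (h : k ≤ m)
    (c : MatSpace k m) (r : ℝ) (hr : segreZonoid k m ⊆ Metric.closedBall c r) :
    segreRadius k ≤ r := by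
  have hk' : (0 : ℝ) < k := by positivity
  have hs : 0 < √(k : ℝ) := Real.sqrt_pos.2 hk'
  set t := segreRadius k / √k with ht
  have ht0 : 0 ≤ t := div_nonneg (segreRadius_pos hk).le hs.le
  have h1 := hr (smul_diagOne_mem_segreZonoid hk h (c := t) (abs_of_nonneg ht0))
  have h2 := hr (smul_diagOne_mem_segreZonoid hk h (c := -t) (by rw [abs_neg, abs_of_nonneg ht0]))
  have h3 := (dist_triangle_right _ _ c).trans (add_le_add h1 h2)
  rw [dist_eq_norm, ← sub_smul, norm_smul, norm_diagOne h, sub_neg_eq_add, Real.norm_eq_abs,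
    abs_of_nonneg (by linarith), add_mul, ht, div_mul_cancel₀ _ hs.ne'] at h3
  linarith

/-- The operator norm is at most the Frobenius norm, so the zonoid contains a Frobenius ball of
radius R_k/√k. -/
theorem volume_segreZonoid_pos {k : ℕ} (hk : 1 ≤ k) (m : ℕ) : 0 < volume (segreZonoid k m) := by
  have hk' : (0 : ℝ) < k := by positivity
  have hs : 0 < √(k : ℝ) := Real.sqrt_pos.2 hk'
  refine (Metric.measure_closedBall_pos volume (0 : MatSpace k m)
    (div_pos (segreRadius_pos hk) hs)).trans_le (measure_mono fun S hS => ?_)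
  rw [mem_closedBall_zero_iff] at hS
  refine mem_segreZonoid_of_norm_transposeMulVec_le hk fun x => ?_
  exact (norm_transposeMulVec_le S x).trans (by gcongr)

/-! ### Lower bound for the volume through the rows. -/

/-- The matrix with given rows. -/
noncomputable def matOfRows {k m : ℕ} (s : Fin k → EuclideanSpace ℝ (Fin m)) : MatSpace k m :=
  WithLp.toLp 2 fun p => s p.1 p.2

theorem measurePreserving_uncurry (ι κ : Type*) [Fintype ι] [Fintype κ] :
    MeasurePreserving (fun (s : ι → κ → ℝ) (p : ι × κ) => s p.1 p.2) := by
  have hm : Measurable (fun (s : ι → κ → ℝ) (p : ι × κ) => s p.1 p.2) := by fun_prop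
  refine ⟨hm, (Measure.pi_eq fun t ht => ?_).symm⟩
  rw [Measure.map_apply hm (MeasurableSet.univ_pi ht)]
  have : (fun (s : ι → κ → ℝ) (p : ι × κ) => s p.1 p.2) ⁻¹' Set.univ.pi t =
      Set.univ.pi fun i => Set.univ.pi fun j => t (i, j) := by
    ext s
    simp [Set.mem_pi]
  rw [this, volume_pi_pi, Fintype.prod_prod_type]
  exact Finset.prod_congr rfl fun i _ => volume_pi_pi _

theorem measurePreserving_matOfRows (k m : ℕ) :
    MeasurePreserving (matOfRows : (Fin k → EuclideanSpace ℝ (Fin m)) → MatSpace k m) :=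
  (PiLp.volume_preserving_toLp (Fin k × Fin m)).comp <|
    (measurePreserving_uncurry (Fin k) (Fin m)).comp <|
    volume_preserving_pi fun _ : Fin k => PiLp.volume_preserving_ofLp (Fin m)

theorem transposeMulVec_matOfRows {k m : ℕ} (s : Fin k → EuclideanSpace ℝ (Fin m))
    (x : EuclideanSpace ℝ (Fin k)) : transposeMulVec (matOfRows s) x = ∑ i, x i • s i := by
  ext j
  simp [transposeMulVec, matOfRows]

theorem matOfRows_mem_segreZonoid {k m : ℕ} (hk : 1 ≤ k) {a c : ℝ} (hc : 0 ≤ c)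
    (h : a ^ 2 * (1 + k * c) ≤ segreRadius k ^ 2 / k) {s : Fin k → EuclideanSpace ℝ (Fin m)}
    (hs : s ∈ nearOrthogonal (EuclideanSpace ℝ (Fin m)) k a c) :
    matOfRows s ∈ segreZonoid k m := by
  refine mem_segreZonoid_of_norm_transposeMulVec_le hk fun x => ?_
  have hr := segreRadius_pos hk
  refine le_of_sq_le_sq ?_ (by positivity)
  rw [transposeMulVec_matOfRows, mul_pow, div_pow, Real.sq_sqrt (by positivity)]
  exact (norm_sum_smul_le_of_mem_nearOrthogonal hc hs x).trans (by gcongr)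

theorem le_volume_segreZonoid {k m : ℕ} (hk : 1 ≤ k) {a c : ℝ} (hc0 : 0 < c) (hc1 : c ≤ 1)
    (h : a ^ 2 * (1 + k * c) ≤ segreRadius k ^ 2 / k) :
    (ENNReal.ofReal (c ^ k) * volume (Metric.closedBall (0 : EuclideanSpace ℝ (Fin m)) a)) ^ k ≤
      volume (segreZonoid k m) := by
  rw [← (measurePreserving_matOfRows k m).measure_preimage
    (segreZonoid_spec k m).2.1.measurableSet.nullMeasurableSet]
  exact (le_volume_nearOrthogonal k k le_rfl hc0 hc1).trans
    (measure_mono fun s hs => matOfRows_mem_segreZonoid hk hc0.le h hs)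


/-! ### Comparison of the logarithms of the volumes. -/

theorem volume_real_closedBall_eq {ι : Type*} [Fintype ι] [Nonempty ι] {r : ℝ} (hr : 0 ≤ r) :
    volume.real (Metric.closedBall (0 : EuclideanSpace ℝ ι) r) =
      r ^ Fintype.card ι *
        (√Real.pi ^ Fintype.card ι / Real.Gamma ((Fintype.card ι : ℝ) / 2 + 1)) := by
  have : 0 < Real.Gamma ((Fintype.card ι : ℝ) / 2 + 1) := Real.Gamma_pos_of_pos (by positivity)
  rw [Measure.real, EuclideanSpace.volume_closedBall, ENNReal.toReal_mul, ENNReal.toReal_pow,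
    ENNReal.toReal_ofReal hr, ENNReal.toReal_ofReal (by positivity)]

theorem log_volume_closedBall {ι : Type*} [Fintype ι] [Nonempty ι] {r : ℝ} (hr : 0 < r) :
    Real.log (volume.real (Metric.closedBall (0 : EuclideanSpace ℝ ι) r)) =
      Fintype.card ι * Real.log r + Fintype.card ι * (Real.log Real.pi / 2) -
        Real.log (Real.Gamma ((Fintype.card ι : ℝ) / 2 + 1)) := by
  have : 0 < Real.Gamma ((Fintype.card ι : ℝ) / 2 + 1) := Real.Gamma_pos_of_pos (by positivity)
  rw [volume_real_closedBall_eq hr.le, Real.log_mul (by positivity) (by positivity),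
    Real.log_div (by positivity) this.ne', Real.log_pow, Real.log_pow, Real.log_sqrt Real.pi_pos.le]
  ring

theorem volume_segreZonoid_ne_top (k m : ℕ) : volume (segreZonoid k m) ≠ ⊤ :=
  (segreZonoid_spec k m).2.1.measure_lt_top.ne

theorem log_volume_segreZonoid_le {k : ℕ} (hk : 1 ≤ k) (m : ℕ) :
    Real.log (volume.real (segreZonoid k m)) ≤ Real.log (volume.real (segreBall k m)) :=
  Real.log_le_log (ENNReal.toReal_pos (volume_segreZonoid_pos hk m).ne'
      (volume_segreZonoid_ne_top k m))
    (measureReal_mono (segreZonoid_subset_segreBall hk m)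
      (isCompact_closedBall _ _).measure_lt_top.ne)

theorem le_log_volume_segreZonoid {k m : ℕ} (hk : 1 ≤ k) (hm : 1 ≤ m) {a c : ℝ} (ha : 0 < a)
    (hc0 : 0 < c) (hc1 : c ≤ 1) (h : a ^ 2 * (1 + k * c) ≤ segreRadius k ^ 2 / k) :
    k * (k * Real.log c + (m * Real.log a + m * (Real.log Real.pi / 2) -
        Real.log (Real.Gamma ((m : ℝ) / 2 + 1)))) ≤
      Real.log (volume.real (segreZonoid k m)) := by
  have : Nonempty (Fin m) := ⟨⟨0, hm⟩⟩
  have h1 := ENNReal.toReal_mono (volume_segreZonoid_ne_top k m)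
    (le_volume_segreZonoid hk hc0 hc1 h)
  rw [ENNReal.toReal_pow, ENNReal.toReal_mul, ENNReal.toReal_ofReal (by positivity)] at h1
  have hb : 0 < volume.real (Metric.closedBall (0 : EuclideanSpace ℝ (Fin m)) a) :=
    ENNReal.toReal_pos (Metric.measure_closedBall_pos _ _ ha).ne'
      (isCompact_closedBall _ _).measure_lt_top.ne
  have h2 := Real.log_le_log (pow_pos (mul_pos (pow_pos hc0 k) hb) k) h1
  have h3 := log_volume_closedBall (ι := Fin m) ha
  rw [Fintype.card_fin] at h3
  rw [Real.log_pow, Real.log_mul (pow_pos hc0 k).ne' hb.ne', Real.log_pow, h3] at h2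
  exact h2

theorem log_Gamma_ge {x : ℝ} (hx : 0 < x) :
    x * (Real.log x - 1) ≤ Real.log (Real.Gamma (x + 1)) := by
  have h := Real.log_le_log (by positivity) (rpow_self_mul_exp_neg_le_Gamma hx)
  rw [Real.log_mul (by positivity) (by positivity), Real.log_rpow hx, Real.log_exp] at h
  linarith

theorem exists_log_Gamma_half_le : ∃ C : ℝ, 0 ≤ C ∧ ∀ n : ℕ, 1 ≤ n →
    Real.log (Real.Gamma ((n : ℝ) / 2 + 1)) ≤
      C + Real.log n + (n : ℝ) / 2 * (Real.log ((n : ℝ) / 2) - 1) := by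
  obtain ⟨C, hC, h⟩ := exists_Gamma_half_le
  refine ⟨|Real.log C|, abs_nonneg _, fun n hn => ?_⟩
  have hn' : (0 : ℝ) < n := by positivity
  have hx : (0 : ℝ) < (n : ℝ) / 2 := by positivity
  have h1 := Real.log_le_log (Real.Gamma_pos_of_pos (by positivity)) (h n hn)
  rw [Real.log_mul hC.ne' (by positivity), Real.log_mul hx.ne' (by positivity),
    Real.log_mul (by positivity) (by positivity), Real.log_rpow hx, Real.log_exp] at h1
  have h2 := Real.log_le_log hx (by linarith : (n : ℝ) / 2 ≤ n)
  have h3 := le_abs_self (Real.log C)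
  linarith

theorem log_volume_segreBall_sub_le {k : ℕ} (hk : 1 ≤ k) : ∃ C : ℝ, 0 ≤ C ∧ ∀ m : ℕ, 1 ≤ m →
    Real.log (volume.real (segreBall k m)) - Real.log (volume.real (segreZonoid k m)) ≤
      C + (k ^ 2 + k) * Real.log m := by
  obtain ⟨C, hC, hΓ⟩ := exists_log_Gamma_half_le
  refine ⟨k ^ 2 / 2 + k * C, by positivity, fun m hm => ?_⟩
  have hk' : (0 : ℝ) < k := by positivity
  have hm' : (0 : ℝ) < m := by positivity
  have hR := segreRadius_pos hk
  have : Nonempty (Fin m) := ⟨⟨0, hm⟩⟩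
  have : Nonempty (Fin k) := ⟨⟨0, hk⟩⟩
  have hq : (0 : ℝ) < k * (1 + k * (1 / m)) := by positivity
  -- The value of `a` giving equality in `ha2` for c = 1/m.
  let a : ℝ := segreRadius k / √(k * (1 + k * (1 / m)))
  have ha : 0 < a := by positivity
  have ha2 : a ^ 2 * (1 + k * (1 / m)) ≤ segreRadius k ^ 2 / k := by
    rw [div_pow, Real.sq_sqrt hq.le]
    apply le_of_eq
    field_simp
  have hla : Real.log a = Real.log (segreRadius k) -
      (Real.log k + Real.log (1 + k * (1 / m))) / 2 := by
    rw [Real.log_div hR.ne' (Real.sqrt_pos.2 hq).ne', Real.log_sqrt hq.le,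
      Real.log_mul hk'.ne' (by positivity)]
  have h1 := le_log_volume_segreZonoid hk hm ha (c := 1 / m) (by positivity)
    (by rw [div_le_one hm']; exact_mod_cast hm) ha2
  rw [hla, one_div (m : ℝ), Real.log_inv, ← one_div] at h1
  have h2 := log_volume_closedBall (ι := Fin k × Fin m) hR
  rw [Fintype.card_prod, Fintype.card_fin, Fintype.card_fin, Nat.cast_mul] at h2
  have h3 := log_Gamma_ge (x := k * m / 2) (by positivity)
  rw [mul_div_assoc, Real.log_mul hk'.ne' (by positivity)] at h3
  rw [mul_div_assoc] at h2
  have h4 := mul_le_mul_of_nonneg_left (hΓ m hm) hk'.le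
  -- The loss from a < R_k/√k stays bounded because c is as small as 1/m; the price of that c is the
  -- term k² log m.
  have h5 : k * (m / 2) * Real.log (1 + k * (1 / m)) ≤ k ^ 2 / 2 := by
    have h6 := Real.log_le_sub_one_of_pos (x := 1 + k * (1 / (m : ℝ))) (by positivity)
    calc k * (m / 2) * Real.log (1 + k * (1 / m)) ≤ k * (m / 2) * (k * (1 / m)) := by
          gcongr; linarith
      _ = k ^ 2 / 2 := by field_simp
  rw [segreBall, h2]
  -- The (km/2) log k from the radius R_k/√k cancels the one in the lower bound for log Γ(km/2 + 1),
  -- as do the terms in log(m/2), log π and log R_k. The `k * log m` left over comes from the upper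
  -- bound on Γ(m/2 + 1).
  linarith

theorem mainTheorem10 (k : ℕ) (hk : 1 ≤ k) :
    (∀ m : ℕ, k ≤ m →
      segreZonoid k m ⊆ segreBall k m ∧
      (∀ (c : MatSpace k m) (r : ℝ), segreZonoid k m ⊆ Metric.closedBall c r → segreRadius k ≤ r) ∧
      0 < volume (segreZonoid k m)) ∧
    (fun m : ℕ => Real.log (volume.real (segreBall k m)) -
        Real.log (volume.real (segreZonoid k m)))
      =O[atTop] (fun m : ℕ => Real.log m) := by
  refine ⟨fun m hm => ⟨segreZonoid_subset_segreBall hk m,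
    segreRadius_le_of_subset_closedBall hk hm, volume_segreZonoid_pos hk m⟩, ?_⟩
  obtain ⟨C, hC, h⟩ := log_volume_segreBall_sub_le hk
  refine IsBigO.of_bound (C + (k ^ 2 + k)) ?_
  -- Since 3 > e, log m ≥ 1 absorbs the additive constant.
  filter_upwards [eventually_ge_atTop 3] with m hm
  have hm' : (3 : ℝ) ≤ m := by exact_mod_cast hm
  have hlog : 1 ≤ Real.log m := by
    rw [Real.le_log_iff_exp_le (by linarith)]
    linarith [Real.exp_one_lt_d9]
  rw [Real.norm_of_nonneg (sub_nonneg.2 (log_volume_segreZonoid_le hk m)),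
    Real.norm_of_nonneg (by linarith)]
  refine (h m (by omega)).trans ?_
  linarith [le_mul_of_one_le_right hC hlog]
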